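/- Let $K$ be an infinite field and let $\Lambda$ be a finite dimensional hereditary $K$-algebra. Let $S_1,\dots,S_n$ be representatives of the isomorphism classes of simple $\Lambda$-modules, and let $P_i$ be the projective cover of $S_i$. For a finitely generated $\Lambda$-module $M$ let $\underline{\dim}\, M\in\mathbb{N}^n$ be the vector whose $i$-th coordinate is the dimension of $\operatorname{Hom}_\Lambda(P_i,M)$ over the division algebra $\operatorname{End}_\Lambda(P_i)$. For $\alpha\in\mathbb{N}^n$ put $P(\alpha)=\bigoplus_i P_i^{\alpha_i}$. Let $d_{ji}$ be the dimension of $\operatorname{Ext}^1_\Lambda(S_j,S_i)$ over $\operatorname{End}_\Lambda(S_i)$, and let $\varphi_j:\bigoplus_i P_i^{d_{ji}}\to\operatorname{rad}P_j$ $(1\le j\le n)$ be any choice of isomorphisms, with induced isomorphism $\varphi_\alpha=\bigoplus_j\varphi_j^{\alpha_j}:\bigoplus_{i,j}P_i^{\alpha_jd_{ji}}\to\operatorname{rad}P(\alpha)$. Let $$H(\Lambda,\alpha)=\prod_i\operatorname{Hom}_\Lambda\Big(\bigoplus_jP_i^{\alpha_jd_{ji}},\,P_i^{\alpha_i}\Big)\subseteq\operatorname{Hom}_\Lambda\Big(\bigoplus_{i,j}P_i^{\alpha_jd_{ji}},\,P(\alpha)\Big),$$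 $$\operatorname{Rep}(\Lambda,\alpha)=\{f\in\operatorname{Hom}_\Lambda(\operatorname{rad}P(\alpha),P(\alpha)) : f\circ\varphi_\alpha\in H(\Lambda,\alpha)\},$$ a finite dimensional $K$-vector space with its Zariski topology, and for $f\in\operatorname{Rep}(\Lambda,\alpha)$ let $N_f$ be the cokernel of $f-\mathrm{inc}:\operatorname{rad}P(\alpha)\to P(\alpha)$, where $\mathrm{inc}$ is the inclusion. Suppose that $M$ is a finitely generated $\Lambda$-module with $\operatorname{Ext}^1_\Lambda(M,M)=0$ (that is, $M$ is rigid) and $\underline{\dim}\,M=\alpha$. Then $$\{f\in\operatorname{Rep}(\Lambda,\alpha) : N_f\cong M\}$$ is open and dense in $\operatorname{Rep}(\Lambda,\alpha)$. In particular the generic representation is determined by $\alpha$ up to isomorphism: every $\Lambda$-module $N$ for which $\{f\in\operatorname{Rep}(\Lambda,\alpha): N_f\cong N\}$ is open and dense is isomorphic to $M$, and so is every finitely generated rigid $\Lambda$-module $N$ with $\underline{\dim}\,N=\alpha$. -/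

import Mathlib

open scoped Topology

universe u v

/-- A ring is (left) hereditary if all its left ideals are projective. -/
def IsHereditaryRing (Λ : Type u) [Ring Λ] : Prop :=
  ∀ I : Ideal Λ, Module.Projective Λ I

section Ext

open CategoryTheory CategoryTheory.Abelian

/-- `Ext¹_Λ(M, N)`, computed in the category of all left `Λ`-modules. -/
abbrev ExtOne (Λ : Type u) [Ring Λ] (M N : Type u) [AddCommGroup M] [Module Λ M]
    [AddCommGroup N] [Module Λ N] : Type u :=
  Ext (ModuleCat.of Λ M) (ModuleCat.of Λ N) 1

/-- The action of `End_Λ(N)` on `Ext¹_Λ(M, N)` by functoriality in `N`. -/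
noncomputable instance ExtOne.moduleEnd (Λ : Type u) [Ring Λ] (M N : Type u)
    [AddCommGroup M] [Module Λ M] [AddCommGroup N] [Module Λ N] :
    Module (Module.End Λ N) (ExtOne Λ M N) where
  smul f x := x.comp (Ext.mk₀ (ModuleCat.ofHom f)) (add_zero 1)
  one_smul x := Ext.comp_mk₀_id x
  mul_smul f g x := by
    change x.comp (Ext.mk₀ (ModuleCat.ofHom g ≫ ModuleCat.ofHom f)) _ =
      (x.comp (Ext.mk₀ (ModuleCat.ofHom g)) _).comp (Ext.mk₀ (ModuleCat.ofHom f)) _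
    rw [← Ext.mk₀_comp_mk₀, Ext.comp_assoc_of_third_deg_zero]
  smul_zero f := Ext.zero_comp _ _ _ _ _
  smul_add f x y := Ext.add_comp _ _ _ _
  add_smul f g x := by
    change x.comp (Ext.mk₀ (ModuleCat.ofHom f + ModuleCat.ofHom g)) _ = _
    rw [Ext.mk₀_add, Ext.comp_add]
    rfl
  zero_smul x := by
    change x.comp (Ext.mk₀ (0 : ModuleCat.of Λ N ⟶ ModuleCat.of Λ N)) _ = _
    rw [Ext.mk₀_zero, Ext.comp_zero]

end Ext

/-- `M` is rigid: `Ext¹_Λ(M, M) = 0`. -/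
def IsRigid (Λ : Type u) [Ring Λ] (M : Type u) [AddCommGroup M] [Module Λ M] : Prop :=
  Subsingleton (ExtOne Λ M M)

/-- `S₁, …, Sₙ` is a list of the simple `Λ`-modules, each isomorphism class occurring once. -/
structure IsCompleteListOfSimples (Λ : Type u) [Ring Λ] {n : ℕ} (S : Fin n → Type u)
    [∀ i, AddCommGroup (S i)] [∀ i, Module Λ (S i)] : Prop where
  simple : ∀ i, IsSimpleModule Λ (S i)
  eq_of_iso : ∀ i j, Nonempty (S i ≃ₗ[Λ] S j) → i = j
  exhaustive : ∀ (T : Type u) [AddCommGroup T] [Module Λ T], IsSimpleModule Λ T →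
    ∃ i, Nonempty (T ≃ₗ[Λ] S i)

/-- `π : P → S` is a projective cover: `P` is projective and `π` is an epimorphism with
superfluous kernel. -/
structure IsProjectiveCover {Λ : Type u} [Ring Λ] {P S : Type u} [AddCommGroup P] [Module Λ P]
    [AddCommGroup S] [Module Λ S] (π : P →ₗ[Λ] S) : Prop where
  projective : Module.Projective Λ P
  surjective : Function.Surjective π
  superfluous : ∀ N : Submodule Λ P, N ⊔ LinearMap.ker π = ⊤ → N = ⊤

/-- The dimension vector of `M`: its `i`-th coordinate is the dimension of `Hom_Λ(P_i, M)` over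
`F_i = End_Λ(P_i)`, which acts on the right, by precomposition. -/
noncomputable def dimVector (Λ : Type u) [Ring Λ] {n : ℕ} (P : Fin n → Type u)
    [∀ i, AddCommGroup (P i)] [∀ i, Module Λ (P i)]
    (M : Type u) [AddCommGroup M] [Module Λ M] : Fin n → ℕ :=
  fun i => Module.finrank (Module.End Λ (P i))ᵈᵐᵃ (P i →ₗ[Λ] M)

/-- `d_{ji}`, the dimension of `Ext¹_Λ(S_j, S_i)` over `F_i = End_Λ(S_i)`. -/
noncomputable def extDim (Λ : Type u) [Ring Λ] {n : ℕ} (S : Fin n → Type u)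
    [∀ i, AddCommGroup (S i)] [∀ i, Module Λ (S i)] (j i : Fin n) : ℕ :=
  Module.finrank (Module.End Λ (S i)) (ExtOne Λ (S j) (S i))

/-- `P(α) = ⨁ᵢ Pᵢ^{αᵢ}`. -/
abbrev ProjSum {n : ℕ} (P : Fin n → Type u) (α : Fin n → ℕ) : Type u :=
  (i : Fin n) → Fin (α i) → P i

/-- `⨁ⱼ (⨁ᵢ Pᵢ^{d_{ji}})^{αⱼ}`. -/
abbrev RadSum {n : ℕ} (P : Fin n → Type u) (d : Fin n → Fin n → ℕ) (α : Fin n → ℕ) : Type u :=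
  (j : Fin n) → Fin (α j) → (i : Fin n) → Fin (d j i) → P i

/-- The `i`-th part `⨁ⱼ Pᵢ^{αⱼ d_{ji}}` of `⨁_{i,j} Pᵢ^{αⱼ d_{ji}}`. -/
abbrev RadSumPart {n : ℕ} (P : Fin n → Type u) (d : Fin n → Fin n → ℕ) (α : Fin n → ℕ)
    (i : Fin n) : Type u :=
  (j : Fin n) → Fin (α j) → Fin (d j i) → P i

/-- The radical of a finite direct sum is the direct sum of the radicals. -/
theorem mem_jacobson_pi_iff (Λ : Type u) [Ring Λ] {ι : Type*} [Finite ι] (M : ι → Type*)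
    [∀ i, AddCommGroup (M i)] [∀ i, Module Λ (M i)] (x : (i : ι) → M i) :
    x ∈ Module.jacobson Λ ((i : ι) → M i) ↔ ∀ i, x i ∈ Module.jacobson Λ (M i) := by
  classical
  have := Fintype.ofFinite ι
  refine ⟨fun h i => Module.jacobson_pi_le Λ M h i trivial, fun h => ?_⟩
  rw [← Finset.univ_sum_single x]
  exact Submodule.sum_mem _ fun i _ =>
    Module.le_comap_jacobson (LinearMap.single Λ M i) (h i)

section Rep

variable (K : Type v) (Λ : Type u) [Field K] [Ring Λ] [Algebra K Λ] {n : ℕ}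
  (P : Fin n → Type u) [∀ i, AddCommGroup (P i)] [∀ i, Module Λ (P i)]
  [∀ i, Module K (P i)] [∀ i, IsScalarTower K Λ (P i)]
  (d : Fin n → Fin n → ℕ) (α : Fin n → ℕ)

/-- The radical of `P(α)`. -/
abbrev radProjSum : Submodule Λ (ProjSum P α) :=
  Module.jacobson Λ (ProjSum P α)

variable {Λ P d} in
/-- The isomorphism `φ_α = ⨁ⱼ φⱼ^{αⱼ}` from `⨁_{i,j} Pᵢ^{αⱼ d_{ji}}` to `rad P(α)` given by
isomorphisms `φⱼ : ⨁ᵢ Pᵢ^{d_{ji}} ≅ rad Pⱼ`. -/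
def radIso (φ : (j : Fin n) → ((i : Fin n) → Fin (d j i) → P i) ≃ₗ[Λ] Module.jacobson Λ (P j)) :
    RadSum P d α ≃ₗ[Λ] radProjSum Λ P α where
  toFun x := ⟨fun j a => φ j (x j a), (mem_jacobson_pi_iff Λ _ _).2 fun j =>
    (mem_jacobson_pi_iff Λ _ _).2 fun a => (φ j (x j a)).2⟩
  invFun y j a := (φ j).symm ⟨y.1 j a,
    (mem_jacobson_pi_iff Λ _ _).1 ((mem_jacobson_pi_iff Λ _ _).1 y.2 j) a⟩
  map_add' x y := by ext j a; simp
  map_smul' c x := by ext j a; simp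
  left_inv x := by ext j a; simp
  right_inv y := by ext j a; simp

/-- The inclusion of `∏ᵢ Hom_Λ(⨁ⱼ Pᵢ^{αⱼ d_{ji}}, Pᵢ^{αᵢ})` in
`Hom_Λ(⨁_{i,j} Pᵢ^{αⱼ d_{ji}}, P(α))` as the space of block diagonal maps. -/
def blockDiagonal :
    ((i : Fin n) → RadSumPart P d α i →ₗ[Λ] (Fin (α i) → P i)) →ₗ[K]
      (RadSum P d α →ₗ[Λ] ProjSum P α) where
  toFun g :=
    { toFun := fun x i => g i (fun j a => x j a i)
      map_add' := fun x y => funext fun i =>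
        (g i).map_add (fun j a => x j a i) (fun j a => y j a i)
      map_smul' := fun c x => funext fun i => (g i).map_smul c (fun j a => x j a i) }
  map_add' _ _ := rfl
  map_smul' _ _ := rfl

/-- `H(Λ, α)`, the block diagonal homomorphisms. -/
def blockHom : Submodule K (RadSum P d α →ₗ[Λ] ProjSum P α) :=
  LinearMap.range (blockDiagonal K Λ P d α)

variable {Λ P d} in
/-- The representation space
`Rep_φ(Λ, α) = {f : rad P(α) → P(α) | f ∘ φ_α ∈ H(Λ, α)}`. -/
def repSpace
    (φ : (j : Fin n) → ((i : Fin n) → Fin (d j i) → P i) ≃ₗ[Λ] Module.jacobson Λ (P j)) :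
    Submodule K (radProjSum Λ P α →ₗ[Λ] ProjSum P α) where
  carrier := {f | f ∘ₗ (radIso α φ).toLinearMap ∈ blockHom K Λ P d α}
  add_mem' hf hg := (blockHom K Λ P d α).add_mem hf hg
  zero_mem' := (blockHom K Λ P d α).zero_mem
  smul_mem' c _ hf := (blockHom K Λ P d α).smul_mem c hf

variable {Λ P α} in
/-- `N_f = coker (f - inc : rad P(α) → P(α))`. -/
abbrev repCoker (f : radProjSum Λ P α →ₗ[Λ] ProjSum P α) : Type u :=
  ProjSum P α ⧸ LinearMap.range (f - (radProjSum Λ P α).subtype)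

variable {Λ P d α} in
/-- The set of points `f` of `Rep_φ(Λ, α)` with `N_f ≅ M`. -/
def isoLocus
    (φ : (j : Fin n) → ((i : Fin n) → Fin (d j i) → P i) ≃ₗ[Λ] Module.jacobson Λ (P j))
    (M : Type u) [AddCommGroup M] [Module Λ M] : Set (repSpace K α φ) :=
  {f | Nonempty (repCoker f.1 ≃ₗ[Λ] M)}

end Rep

section Zariski

variable (K : Type*) (V : Type*) [Field K] [AddCommGroup V] [Module K V]

/-- The algebra of polynomial functions on a vector space, generated by the linear forms. -/
def polyFunctions : Subalgebra K (V → K) :=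
  Algebra.adjoin K (Set.range fun l : Module.Dual K V => (l : V → K))

/-- The Zariski topology on (the `K`-points of) a finite dimensional vector space, viewed as an
affine space: it is generated by the nonvanishing sets of the polynomial functions. -/
abbrev zariskiTopology : TopologicalSpace V :=
  TopologicalSpace.generateFrom
    {U | ∃ p ∈ polyFunctions K V, U = {x | p x ≠ 0}}

end Zariski

/-! Openness: for `f` in the representation space, `f - inc` is injective and gives a projective
presentation of `N_f`. If `N_f` is rigid, then `(h, h') ↦ h ∘ (f - inc) - (f - inc) ∘ h'` maps onto
`Hom(rad P(α), P(α))`. So the linear equation `h ∘ (f - inc) = (g - inc) ∘ h'`, solved at `g = f` by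
`(id, id)`, keeps a solution near `f`. By Cramer's rule the solution depends polynomially on `g`, so
it stays invertible on a Zariski neighbourhood, where `N_g ≅ N_f`
(`exists_polyFunctions_quotient_equiv`).

Nonemptiness: `End(P i)` is a division ring, and bases of the spaces `Hom(P i, M)` assemble into a
surjection `P(α) → M`. Expanding its restriction to the summands of `rad P(α)` in these bases
defines `f`. Linear independence makes `N_f → M` injective (`nonempty_isoLocus`); rigidity plays no
role here.

An affine space over an infinite field is irreducible, so nonempty open sets are dense. Uniqueness
follows since a dense set meets a nonempty open one. -/

/-! ### Polynomial functions and the Zariski topology -/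

section PolynomialFunctions

variable {K V W : Type*} [Field K] [AddCommGroup V] [Module K V] [AddCommGroup W] [Module K W]

theorem dual_mem_polyFunctions (l : Module.Dual K V) : (fun x => l x) ∈ polyFunctions K V :=
  Algebra.subset_adjoin ⟨l, rfl⟩

theorem const_mem_polyFunctions (c : K) : (fun _ : V => c) ∈ polyFunctions K V :=
  (polyFunctions K V).algebraMap_mem c

theorem comp_mem_polyFunctions {p : W → K} (hp : p ∈ polyFunctions K W) {w : V → W}
    (hw : ∀ l : Module.Dual K W, (fun x => l (w x)) ∈ polyFunctions K V) :
    (fun x => p (w x)) ∈ polyFunctions K V := by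
  induction hp using Algebra.adjoin_induction with
  | mem p hp => obtain ⟨l, rfl⟩ := hp; exact hw l
  | algebraMap c => exact const_mem_polyFunctions c
  | add p q _ _ hp hq => exact add_mem hp hq
  | mul p q _ _ hp hq => exact mul_mem hp hq

theorem det_mem_polyFunctions {ι : Type*} [Fintype ι] [DecidableEq ι] {B : V → Matrix ι ι K}
    (hB : ∀ i j, (fun x => B x i j) ∈ polyFunctions K V) :
    (fun x => (B x).det) ∈ polyFunctions K V := by
  have : (fun x => (B x).det) =
      ∑ σ : Equiv.Perm ι, Equiv.Perm.sign σ • ∏ i, fun x => B x (σ i) i := by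
    ext x
    simp [Matrix.det_apply]
  rw [this]
  refine sum_mem fun σ _ => ?_
  have h := prod_mem (S := polyFunctions K V) (t := Finset.univ) fun i _ => hB (σ i) i
  rcases Int.units_eq_one_or (Equiv.Perm.sign σ) with hs | hs
  · rw [hs, one_smul]; exact h
  · rw [hs, Units.neg_smul, one_smul]; exact neg_mem h

theorem adjugate_mem_polyFunctions {ι : Type*} [Fintype ι] [DecidableEq ι]
    {B : V → Matrix ι ι K} (hB : ∀ i j, (fun x => B x i j) ∈ polyFunctions K V) (i j : ι) :
    (fun x => (B x).adjugate i j) ∈ polyFunctions K V := by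
  simp only [Matrix.adjugate_apply]
  refine det_mem_polyFunctions fun k l => ?_
  by_cases hk : k = j
  · subst hk
    simpa using const_mem_polyFunctions (V := V) (Pi.single (M := fun _ => K) i 1 l)
  · simpa [Matrix.updateRow_ne hk] using hB k l

theorem linearMap_det_mem_polyFunctions [FiniteDimensional K W]
    (L : V →ₗ[K] W →ₗ[K] W) : (fun x => LinearMap.det (L x)) ∈ polyFunctions K V := by
  let b := Module.finBasis K W
  have : (fun x => LinearMap.det (L x)) = fun x => (LinearMap.toMatrix b b (L x)).det := by
    ext x
    rw [LinearMap.det_toMatrix]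
  rw [this]
  refine det_mem_polyFunctions fun i j => ?_
  simpa [LinearMap.toMatrix_apply] using
    dual_mem_polyFunctions (K := K) ((b.coord i).comp (L.flip (b j)))

/-- A kernel vector of a surjective linear map deforms, along an affine family of linear maps, to
kernel vectors which depend polynomially on the parameter. -/
theorem exists_polyFunctions_ker_deformation {E : Type*} [AddCommGroup E] [Module K E]
    [FiniteDimensional K W] (A₀ : V →ₗ[K] W) (L : E →ₗ[K] V →ₗ[K] W) (e : E)
    (hsurj : Function.Surjective (A₀ + L e)) (v₀ : V) (hv₀ : (A₀ + L e) v₀ = 0)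
    {q : V → K} (hq : q ∈ polyFunctions K V) (hqv : q v₀ ≠ 0) :
    ∃ p ∈ polyFunctions K E, p e ≠ 0 ∧ ∀ x, p x ≠ 0 → ∃ v, (A₀ + L x) v = 0 ∧ q v ≠ 0 := by
  obtain ⟨s, hs⟩ := LinearMap.exists_rightInverse_of_surjective (A₀ + L e)
    (LinearMap.range_eq_top.2 hsurj)
  let b := Module.finBasis K W
  let B : E → Matrix _ _ K := fun x => LinearMap.toMatrix b b ((A₀ + L x) ∘ₗ s)
  have haff (v : V) (l : Module.Dual K W) :
      (fun x => l ((A₀ + L x) v)) ∈ polyFunctions K E := by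
    have := add_mem (const_mem_polyFunctions (V := E) (l (A₀ v)))
      (dual_mem_polyFunctions (K := K) (l.comp (L.flip v)))
    convert this using 1
    ext x
    simp
  have hB : ∀ i j, (fun x => B x i j) ∈ polyFunctions K E := fun i j => by
    simpa [B, LinearMap.toMatrix_apply] using haff (s (b j)) (b.coord i)
  -- Newton-type correction of `v₀` along the section `s`, multiplied by `det (B x)` so that the
  -- inverse of `B x` becomes its adjugate and no division occurs.
  let w : E → V := fun x => (B x).det • v₀ -
    s (Matrix.toLin b b (B x).adjugate ((A₀ + L x) v₀))
  have hBe : B e = 1 := by simp only [B]; rw [hs, LinearMap.toMatrix_id]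
  have hwe : w e = v₀ := by simp only [w]; rw [hBe, hv₀]; simp
  have hw (x : E) : (A₀ + L x) (w x) = 0 := by
    have h1 : ((A₀ + L x) ∘ₗ s) = Matrix.toLin b b (B x) := by simp [B]
    have h2 : (A₀ + L x) (s (Matrix.toLin b b (B x).adjugate ((A₀ + L x) v₀))) =
        (B x).det • (A₀ + L x) v₀ := by
      change ((A₀ + L x) ∘ₗ s) _ = _
      rw [h1, ← Matrix.toLin_mul_apply, Matrix.mul_adjugate, map_smul]
      simp
    simp only [w]
    rw [map_sub, map_smul, h2, sub_self]
  have hpoly : ∀ l : Module.Dual K V, (fun x => l (w x)) ∈ polyFunctions K E := fun l => by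
    have hsum : (fun x => l (w x)) = (fun x => (B x).det) * (fun _ => l v₀) -
        ∑ i, ∑ j, (fun x => (B x).adjugate i j) * (fun x => b.coord j ((A₀ + L x) v₀)) *
          (fun _ => l (s (b i))) := by
      ext x
      simp [w, Matrix.toLin_apply, Matrix.mulVec, dotProduct, Finset.sum_mul]
    rw [hsum]
    exact sub_mem (mul_mem (det_mem_polyFunctions hB) (const_mem_polyFunctions _))
      (sum_mem fun i _ => sum_mem fun j _ => mul_mem (mul_mem
        (adjugate_mem_polyFunctions hB i j) (haff v₀ (b.coord j))) (const_mem_polyFunctions _))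
  exact ⟨_, comp_mem_polyFunctions hq hpoly, by simpa only [hwe] using hqv,
    fun x hx => ⟨w x, hw x, hx⟩⟩

/-- The restriction of a polynomial function to a line is a polynomial. -/
theorem exists_polynomial_eval_line {p : V → K} (hp : p ∈ polyFunctions K V) (x y : V) :
    ∃ P : Polynomial K, ∀ t : K, P.eval t = p (x + t • y) := by
  induction hp using Algebra.adjoin_induction with
  | mem p hp =>
    obtain ⟨l, rfl⟩ := hp
    exact ⟨.C (l x) + .X * .C (l y), fun t => by simp; exact mul_comm _ _⟩
  | algebraMap c => exact ⟨.C c, fun t => by simp⟩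
  | add p q _ _ hp hq =>
    obtain ⟨P, hP⟩ := hp
    obtain ⟨Q, hQ⟩ := hq
    exact ⟨P + Q, fun t => by simp [hP, hQ]⟩
  | mul p q _ _ hp hq =>
    obtain ⟨P, hP⟩ := hp
    obtain ⟨Q, hQ⟩ := hq
    exact ⟨P * Q, fun t => by simp [hP, hQ]⟩

/-- On the line through `x` and `y` both functions become nonzero polynomials in one variable; their
product is nonzero, hence not identically zero on an infinite field. -/
theorem exists_ne_zero_of_mem_polyFunctions [Infinite K] {p q : V → K}
    (hp : p ∈ polyFunctions K V) (hq : q ∈ polyFunctions K V) {x y : V} (hx : p x ≠ 0)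
    (hy : q y ≠ 0) : ∃ z, p z ≠ 0 ∧ q z ≠ 0 := by
  obtain ⟨P, hP⟩ := exists_polynomial_eval_line hp x (y - x)
  obtain ⟨Q, hQ⟩ := exists_polynomial_eval_line hq x (y - x)
  have hP0 : P ≠ 0 := by
    rintro rfl
    exact hx (by simpa using (hP 0).symm)
  have hQ0 : Q ≠ 0 := by
    rintro rfl
    exact hy (by simpa using (hQ 1).symm)
  by_contra! h
  refine mul_ne_zero hP0 hQ0 (Polynomial.funext fun t => ?_)
  rw [Polynomial.eval_mul, hP, hQ, Polynomial.eval_zero]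
  by_cases h0 : p (x + t • (y - x)) = 0
  · rw [h0, zero_mul]
  · rw [h _ h0, mul_zero]

/-- The generating sets are closed under intersection, by multiplying functions, so they form a
basis. -/
theorem exists_polyFunctions_of_isOpen {U : Set V} (hU : IsOpen[zariskiTopology K V] U) {x : V}
    (hx : x ∈ U) : ∃ p ∈ polyFunctions K V, p x ≠ 0 ∧ ∀ y, p y ≠ 0 → y ∈ U := by
  induction hU generalizing x with
  | basic U hU =>
    obtain ⟨p, hp, rfl⟩ := hU
    exact ⟨p, hp, hx, fun y hy => hy⟩
  | univ => exact ⟨1, one_mem _, one_ne_zero, fun _ _ => trivial⟩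
  | inter U U' _ _ h h' =>
    obtain ⟨p, hp, hpx, hpU⟩ := h hx.1
    obtain ⟨q, hq, hqx, hqU⟩ := h' hx.2
    refine ⟨p * q, mul_mem hp hq, mul_ne_zero hpx hqx, fun y hy => ?_⟩
    exact ⟨hpU y (left_ne_zero_of_mul hy), hqU y (right_ne_zero_of_mul hy)⟩
  | sUnion 𝒰 _ h =>
    obtain ⟨U, hU, hxU⟩ := hx
    obtain ⟨p, hp, hpx, hpU⟩ := h U hU hxU
    exact ⟨p, hp, hpx, fun y hy => ⟨U, hU, hpU y hy⟩⟩

theorem isOpen_zariski_of_forall {U : Set V}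
    (h : ∀ x ∈ U, ∃ p ∈ polyFunctions K V, p x ≠ 0 ∧ ∀ y, p y ≠ 0 → y ∈ U) :
    IsOpen[zariskiTopology K V] U := by
  let := zariskiTopology K V
  refine isOpen_iff_forall_mem_open.2 fun x hx => ?_
  obtain ⟨p, hp, hpx, hpU⟩ := h x hx
  exact ⟨{y | p y ≠ 0}, hpU, TopologicalSpace.isOpen_generateFrom_of_mem ⟨p, hp, rfl⟩, hpx⟩

/-- The affine space over an infinite field is irreducible. -/
theorem dense_zariski_of_isOpen [Infinite K] {U : Set V} (hU : IsOpen[zariskiTopology K V] U)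
    (hne : U.Nonempty) : @Dense _ (zariskiTopology K V) U := by
  let := zariskiTopology K V
  refine dense_iff_inter_open.2 fun U' hU' ⟨y, hy⟩ => ?_
  obtain ⟨x, hx⟩ := hne
  obtain ⟨p, hp, hpx, hpU⟩ := exists_polyFunctions_of_isOpen hU hx
  obtain ⟨q, hq, hqy, hqU⟩ := exists_polyFunctions_of_isOpen hU' hy
  obtain ⟨z, hz, hz'⟩ := exists_ne_zero_of_mem_polyFunctions hp hq hpx hqy
  exact ⟨z, hqU z hz', hpU z hz⟩

end PolynomialFunctions

/-! ### Rigidity as an extension property -/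

section Rigid

open CategoryTheory CategoryTheory.Abelian

/-- Over a rigid module `M` with a presentation `0 → R → P → M → 0`, every map `R → M` extends
to `P`. -/
theorem IsRigid.exists_extension {Λ : Type u} [Ring Λ] {R P M : Type u} [AddCommGroup R]
    [Module Λ R] [AddCommGroup P] [Module Λ P] [AddCommGroup M] [Module Λ M] (hM : IsRigid Λ M)
    (i : R →ₗ[Λ] P) (p : P →ₗ[Λ] M) (hi : Function.Injective i) (hp : Function.Surjective p)
    (hip : Function.Exact i p) (θ : R →ₗ[Λ] M) : ∃ u : P →ₗ[Λ] M, u ∘ₗ i = θ := by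
  let T : ShortComplex (ModuleCat.{u} Λ) := ShortComplex.mk (ModuleCat.ofHom i)
    (ModuleCat.ofHom p) (by ext x; exact hip.apply_apply_eq_zero x)
  have hT : T.ShortExact :=
    { exact := (ShortComplex.ShortExact.moduleCat_exact_iff_function_exact T).2 hip
      mono_f := (ModuleCat.mono_iff_injective _).2 hi
      epi_g := (ModuleCat.epi_iff_surjective _).2 hp }
  have : Subsingleton (Ext (ModuleCat.of Λ M) (ModuleCat.of Λ M) 1) := hM
  -- Exactness of `Hom(P, M) → Hom(R, M) → Ext¹(M, M) = 0`.
  obtain ⟨y, hy⟩ := Ext.contravariant_sequence_exact₁ hT (ModuleCat.of Λ M)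
    (Ext.mk₀ (ModuleCat.ofHom θ)) (add_zero 1) (Subsingleton.elim (α := Ext T.X₃ _ 1) _ _)
  obtain ⟨w, rfl⟩ := Ext.addEquiv₀.symm.surjective y
  refine ⟨w.hom, ?_⟩
  have hy' : Ext.mk₀ (T.f ≫ w) = Ext.mk₀ (ModuleCat.ofHom θ) := by
    rw [← hy]
    exact (Ext.mk₀_comp_mk₀ _ _).symm
  have := Ext.addEquiv₀.symm.injective hy'
  exact congrArg ModuleCat.Hom.hom this

end Rigid

/-! ### Deforming presentations of a rigid module -/

section Deformation

variable {K : Type v} {Λ : Type u} [Field K] [Ring Λ] [Algebra K Λ]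

theorem finite_linearMap {X Y : Type*} [AddCommGroup X] [AddCommGroup Y] [Module Λ X]
    [Module Λ Y] [Module K X] [Module K Y] [IsScalarTower K Λ X] [IsScalarTower K Λ Y]
    [Module.Finite K X] [Module.Finite K Y] : Module.Finite K (X →ₗ[Λ] Y) :=
  Module.Finite.of_injective (LinearMap.restrictScalarsₗ K Λ X Y K)
    (LinearMap.restrictScalars_injective K)

theorem bijective_of_det_restrictScalars_ne_zero {X : Type*} [AddCommGroup X] [Module Λ X]
    [Module K X] [IsScalarTower K Λ X] [Module.Finite K X] {h : X →ₗ[Λ] X}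
    (hh : LinearMap.det (h.restrictScalars K) ≠ 0) : Function.Bijective h :=
  (LinearMap.equivOfDetNeZero (h.restrictScalars K) hh).bijective

theorem nonempty_quotient_range_equiv {R P : Type*} [AddCommGroup R] [Module Λ R]
    [AddCommGroup P] [Module Λ P] {i j : R →ₗ[Λ] P} {h : P →ₗ[Λ] P} {h' : R →ₗ[Λ] R}
    (hh : Function.Bijective h) (hh' : Function.Bijective h') (hc : h ∘ₗ i = j ∘ₗ h') :
    Nonempty ((P ⧸ LinearMap.range i) ≃ₗ[Λ] P ⧸ LinearMap.range j) := by
  refine ⟨Submodule.Quotient.equiv _ _ (LinearEquiv.ofBijective h hh) ?_⟩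
  have : (LinearMap.range i).map h = LinearMap.range j := by
    rw [← LinearMap.range_comp, hc, LinearMap.range_comp, LinearMap.range_eq_top.2 hh'.2,
      Submodule.map_top]
  exact this

/-- If the cokernel of an injective map between finite dimensional projective modules is rigid,
then nearby maps have isomorphic cokernels. -/
theorem exists_polyFunctions_quotient_equiv {R P M : Type u} [AddCommGroup R] [Module Λ R]
    [AddCommGroup P] [Module Λ P] [AddCommGroup M] [Module Λ M] [Module K R]
    [IsScalarTower K Λ R] [Module K P] [IsScalarTower K Λ P] [Module.Finite K R]
    [Module.Finite K P] [Module.Projective Λ R] [Module.Projective Λ P]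
    (E : Submodule K (R →ₗ[Λ] P)) (i : R →ₗ[Λ] P) (f : E)
    (hinj : Function.Injective (f.1 - i)) (e : (P ⧸ LinearMap.range (f.1 - i)) ≃ₗ[Λ] M)
    (hM : IsRigid Λ M) :
    ∃ p ∈ polyFunctions K E, p f ≠ 0 ∧ ∀ g : E, p g ≠ 0 →
      Nonempty ((P ⧸ LinearMap.range (g.1 - i)) ≃ₗ[Λ] M) := by
  have := finite_linearMap (K := K) (Λ := Λ) (X := R) (Y := P)
  -- `A₀ + L g` is to be `(h, h') ↦ h ∘ (f - i) - (g - i) ∘ h'`; `L` collects the part linear in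
  -- `g`.
  let A₀ : ((P →ₗ[Λ] P) × (R →ₗ[Λ] R)) →ₗ[K] (R →ₗ[Λ] P) :=
    { toFun v := v.1 ∘ₗ (f.1 - i) + i ∘ₗ v.2
      map_add' v w := by ext x; simp; abel
      map_smul' c v := by
        ext x
        simp only [Prod.smul_fst, Prod.smul_snd, LinearMap.add_apply, LinearMap.comp_apply,
          LinearMap.smul_apply, smul_add, RingHom.id_apply]
        rw [LinearMap.map_smul_of_tower] }
  let L : E →ₗ[K] ((P →ₗ[Λ] P) × (R →ₗ[Λ] R)) →ₗ[K] (R →ₗ[Λ] P) :=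
    LinearMap.mk₂ K (fun g v => -(g.1 ∘ₗ v.2))
      (fun g g' v => by ext x; simp; abel)
      (fun c g v => by ext x; simp)
      (fun g v w => by ext x; simp; abel)
      (fun c g v => by
        ext x
        simp only [Prod.smul_snd, LinearMap.neg_apply, LinearMap.comp_apply,
          LinearMap.smul_apply]
        rw [LinearMap.map_smul_of_tower, smul_neg])
  have hA (g : E) (v : (P →ₗ[Λ] P) × (R →ₗ[Λ] R)) :
      (A₀ + L g) v = v.1 ∘ₗ (f.1 - i) - (g.1 - i) ∘ₗ v.2 := by
    ext x
    simp [A₀, L]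
    abel
  let p : P →ₗ[Λ] M := e.toLinearMap ∘ₗ (LinearMap.range (f.1 - i)).mkQ
  have hp : Function.Surjective p := e.surjective.comp (Submodule.mkQ_surjective _)
  have hker (y : P) : p y = 0 ↔ y ∈ LinearMap.range (f.1 - i) := by simp [p]
  -- Rigidity extends `p ∘ θ` to `w : P → M`, which lifts to `h`. The error `h ∘ (f - i) - θ` is
  -- killed by `p`, so it factors through `f - i` by projectivity of `R`.
  have hsurj : Function.Surjective (A₀ + L f) := fun θ => by
    obtain ⟨w, hw⟩ := hM.exists_extension (f.1 - i) p hinj hp hker (p ∘ₗ θ)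
    obtain ⟨h, hh⟩ := Module.projective_lifting_property p w hp
    obtain ⟨h', hh'⟩ := Module.projective_lifting_property (f.1 - i).rangeRestrict
      ((h ∘ₗ (f.1 - i) - θ).codRestrict (LinearMap.range (f.1 - i)) fun x => by
        rw [← hker, LinearMap.sub_apply, map_sub, sub_eq_zero]
        exact (congr($hh _)).trans congr($hw x)) (LinearMap.surjective_rangeRestrict _)
    refine ⟨(h, h'), ?_⟩
    rw [hA, sub_eq_iff_eq_add, ← sub_eq_iff_eq_add']
    ext x
    exact congr(($hh' x).1).symm
  let q : (P →ₗ[Λ] P) × (R →ₗ[Λ] R) → K := fun v =>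
    LinearMap.det (v.1.restrictScalars K) * LinearMap.det (v.2.restrictScalars K)
  have hq : q ∈ polyFunctions K _ := mul_mem
    (linearMap_det_mem_polyFunctions
      (LinearMap.restrictScalarsₗ K Λ P P K ∘ₗ LinearMap.fst K (P →ₗ[Λ] P) (R →ₗ[Λ] R)))
    (linearMap_det_mem_polyFunctions
      (LinearMap.restrictScalarsₗ K Λ R R K ∘ₗ LinearMap.snd K (P →ₗ[Λ] P) (R →ₗ[Λ] R)))
  obtain ⟨r, hr, hrf, hrg⟩ := exists_polyFunctions_ker_deformation A₀ L f hsurj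
    (LinearMap.id, LinearMap.id) (by rw [hA]; simp) hq (by simp [q])
  refine ⟨r, hr, hrf, fun g hg => ?_⟩
  obtain ⟨v, hv, hqv⟩ := hrg g hg
  rw [hA, sub_eq_zero] at hv
  obtain ⟨e'⟩ := nonempty_quotient_range_equiv
    (bijective_of_det_restrictScalars_ne_zero (left_ne_zero_of_mul hqv))
    (bijective_of_det_restrictScalars_ne_zero (right_ne_zero_of_mul hqv)) hv
  exact ⟨e'.symm.trans e⟩

end Deformation

/-! ### Projective covers of simple modules -/

namespace IsProjectiveCover

variable {Λ : Type u} [Ring Λ] {P S : Type u} [AddCommGroup P] [Module Λ P]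
  [AddCommGroup S] [Module Λ S] {π : P →ₗ[Λ] S}

/-- The kernel is maximal, so a submodule outside it would span `P` together with it, against
superfluity. Thus `ker π` is the unique maximal submodule. -/
theorem le_ker [IsSimpleModule Λ S] (hπ : IsProjectiveCover π) {N : Submodule Λ P} (hN : N ≠ ⊤) :
    N ≤ LinearMap.ker π := by
  by_contra h
  refine hN (hπ.superfluous N ?_)
  exact (LinearMap.isCoatom_ker_of_surjective hπ.surjective).2 _
    (lt_of_le_of_ne le_sup_right fun he => h (sup_eq_right.1 he.symm))

theorem jacobson_eq_ker [IsSimpleModule Λ S] (hπ : IsProjectiveCover π) :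
    Module.jacobson Λ P = LinearMap.ker π := by
  have hc := LinearMap.isCoatom_ker_of_surjective hπ.surjective
  refine le_antisymm (sInf_le hc) (le_sInf fun N hN => ?_)
  exact ((hN.le_iff_eq hc.1).1 (hπ.le_ker hN.1)).le

theorem jacobson_ne_top [IsSimpleModule Λ S] (hπ : IsProjectiveCover π) :
    Module.jacobson Λ P ≠ ⊤ := by
  rw [hπ.jacobson_eq_ker]
  exact (LinearMap.isCoatom_ker_of_surjective hπ.surjective).1

theorem exists_span_singleton_eq_top [IsSimpleModule Λ S] (hπ : IsProjectiveCover π) :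
    ∃ x : P, Submodule.span Λ {x} = ⊤ := by
  have := IsSimpleModule.nontrivial Λ S
  obtain ⟨s, hs⟩ := exists_ne (0 : S)
  obtain ⟨x, rfl⟩ := hπ.surjective s
  refine ⟨x, by_contra fun h => hs ?_⟩
  exact hπ.le_ker h (Submodule.mem_span_singleton_self x)

theorem finite [IsSimpleModule Λ S] (hπ : IsProjectiveCover π) : Module.Finite Λ P := by
  obtain ⟨x, hx⟩ := hπ.exists_span_singleton_eq_top
  exact ⟨⟨{x}, by simpa using hx⟩⟩

/-- Over a hereditary ring, submodules of a projective cover of a simple module are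
projective. -/
theorem projective_submodule [IsSimpleModule Λ S] (hΛ : IsHereditaryRing Λ)
    (hπ : IsProjectiveCover π) (N : Submodule Λ P) : Module.Projective Λ N := by
  obtain ⟨x, hx⟩ := hπ.exists_span_singleton_eq_top
  have := hπ.projective
  have hsurj : Function.Surjective (LinearMap.toSpanSingleton Λ P x) := by
    rw [← LinearMap.range_eq_top, LinearMap.range_toSpanSingleton, hx]
  -- `P` is cyclic and projective, so `s` embeds it, and with it `N`, as a left ideal.
  obtain ⟨s, hs⟩ := Module.projective_lifting_property _ LinearMap.id hsurj
  have hinj : Function.Injective s := fun a b hab => by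
    rw [← LinearMap.id_apply (R := Λ) a, ← LinearMap.id_apply (R := Λ) b, ← hs,
      LinearMap.comp_apply, LinearMap.comp_apply, hab]
  have := hΛ (N.map s)
  exact Module.Projective.of_equiv' (N.equivMapOfInjective s hinj).symm

/-- The image of `c` is projective, so `P` splits off `ker c`. As `ker c` is proper it is
superfluous, and the complement is all of `P`. -/
theorem injective_of_ne_zero [IsSimpleModule Λ S] (hΛ : IsHereditaryRing Λ)
    (hπ : IsProjectiveCover π) {P' S' : Type u} [AddCommGroup P'] [Module Λ P'] [AddCommGroup S']
    [Module Λ S'] [IsSimpleModule Λ S'] {π' : P' →ₗ[Λ] S'} (hπ' : IsProjectiveCover π')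
    {c : P →ₗ[Λ] P'} (hc : c ≠ 0) : Function.Injective c := by
  have := hπ'.projective_submodule hΛ (LinearMap.range c)
  obtain ⟨s, hs⟩ := Module.projective_lifting_property c.rangeRestrict LinearMap.id
    c.surjective_rangeRestrict
  have hs' (y : LinearMap.range c) : c (s y) = y := congr(($hs y).1)
  have hker : LinearMap.ker c ≤ LinearMap.ker π :=
    hπ.le_ker fun h => hc (LinearMap.ker_eq_top.1 h)
  have htop : LinearMap.range s = ⊤ := hπ.superfluous _ <| by
    rw [eq_top_iff]
    intro x _
    rw [← add_sub_cancel (s (c.rangeRestrict x)) x]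
    refine Submodule.add_mem_sup (LinearMap.mem_range_self _ _) (hker ?_)
    rw [LinearMap.mem_ker, map_sub, hs', sub_eq_zero]
    rfl
  intro a b hab
  obtain ⟨a, rfl⟩ := LinearMap.range_eq_top.1 htop a
  obtain ⟨b, rfl⟩ := LinearMap.range_eq_top.1 htop b
  rw [hs', hs'] at hab
  rw [Subtype.ext hab]

theorem bijective_of_ne_zero [IsArtinianRing Λ] [IsSimpleModule Λ S] (hΛ : IsHereditaryRing Λ)
    (hπ : IsProjectiveCover π) {c : P →ₗ[Λ] P} (hc : c ≠ 0) : Function.Bijective c := by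
  have := hπ.finite
  exact IsArtinian.bijective_of_injective_endomorphism c (hπ.injective_of_ne_zero hΛ hπ hc)

/-- Maps between projective covers of nonisomorphic simple modules are radical. -/
theorem apply_mem_jacobson [IsSimpleModule Λ S] (hπ : IsProjectiveCover π) {P' S' : Type u}
    [AddCommGroup P'] [Module Λ P'] [AddCommGroup S'] [Module Λ S'] [IsSimpleModule Λ S']
    {π' : P' →ₗ[Λ] S'} (hπ' : IsProjectiveCover π') (hS : IsEmpty (S ≃ₗ[Λ] S'))
    (c : P →ₗ[Λ] P') (x : P) : c x ∈ Module.jacobson Λ P' := by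
  rw [hπ'.jacobson_eq_ker, LinearMap.mem_ker, ← LinearMap.comp_apply]
  by_contra hx
  have h0 : π' ∘ₗ c ≠ 0 := fun h => hx (by rw [h, LinearMap.zero_apply])
  have hs : Function.Surjective (π' ∘ₗ c) := LinearMap.surjective_of_ne_zero h0
  have hco := LinearMap.isCoatom_ker_of_surjective hs
  have he : LinearMap.ker π = LinearMap.ker (π' ∘ₗ c) :=
    (hco.le_iff_eq (LinearMap.isCoatom_ker_of_surjective hπ.surjective).1).1 (hπ.le_ker hco.1)
  exact hS.false ((LinearMap.quotKerEquivOfSurjective π hπ.surjective).symm.trans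
    ((Submodule.quotEquivOfEq _ _ he).trans (LinearMap.quotKerEquivOfSurjective _ hs)))

end IsProjectiveCover

/-! ### Hom spaces over endomorphism rings -/

/-- A basis of `Hom_Λ(P, M)` over `End_Λ(P)`, if the latter is a division ring. -/
theorem exists_basis_hom {Λ : Type u} [Ring Λ] {P M : Type u} [AddCommGroup P] [Module Λ P]
    [AddCommGroup M] [Module Λ M] (hdiv : ∀ c : Module.End Λ P, c ≠ 0 → Function.Bijective c)
    [Nontrivial P] [Module.Finite (Module.End Λ P)ᵈᵐᵃ (P →ₗ[Λ] M)] {r : ℕ}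
    (hr : Module.finrank (Module.End Λ P)ᵈᵐᵃ (P →ₗ[Λ] M) = r) :
    ∃ m : Fin r → (P →ₗ[Λ] M),
      (∀ h : P →ₗ[Λ] M, ∃ t : Fin r → (P →ₗ[Λ] P), ∑ a, m a ∘ₗ t a = h) ∧
      ∀ t : Fin r → (P →ₗ[Λ] P), ∑ a, m a ∘ₗ t a = 0 → t = 0 := by
  have hu (a : (Module.End Λ P)ᵈᵐᵃ) : IsUnit a ∨ a = 0 := by
    by_cases ha : DomMulAct.mk.symm a = 0
    · exact Or.inr (DomMulAct.mk.symm.injective ha)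
    · left
      have : IsUnit (DomMulAct.mk.symm a) := (Module.End.isUnit_iff _).2 (hdiv _ ha)
      exact this.op
  have : Nontrivial (Module.End Λ P)ᵈᵐᵃ :=
    inferInstanceAs (Nontrivial (Module.End Λ P)ᵐᵒᵖ)
  let : DivisionRing (Module.End Λ P)ᵈᵐᵃ := DivisionRing.ofIsUnitOrEqZero hu
  let b : Module.Basis (Fin r) (Module.End Λ P)ᵈᵐᵃ (P →ₗ[Λ] M) :=
    Module.finBasisOfFinrankEq _ _ hr
  refine ⟨b, fun h => ⟨fun a => DomMulAct.mk.symm (b.repr h a), b.sum_repr h⟩, fun t ht => ?_⟩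
  have := Fintype.linearIndependent_iff.1 b.linearIndependent (fun a => DomMulAct.mk (t a)) ht
  exact funext fun a => DomMulAct.mk.injective (this a)

theorem finite_hom_dma {K : Type v} {Λ : Type u} [Field K] [Ring Λ] [Algebra K Λ]
    {P M : Type u} [AddCommGroup P] [Module Λ P] [AddCommGroup M] [Module Λ M]
    [Module K P] [IsScalarTower K Λ P] [Module.Finite K P] [Module.Finite K Λ]
    [Module.Finite Λ M] : Module.Finite (Module.End Λ P)ᵈᵐᵃ (P →ₗ[Λ] M) := by
  let : Module K M := Module.compHom M (algebraMap K Λ)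
  have : IsScalarTower K Λ M := ⟨fun k c x => by
    rw [Algebra.smul_def, mul_smul]
    rfl⟩
  have : Module.Finite K M := Module.Finite.trans Λ M
  obtain ⟨s, hs⟩ := (finite_linearMap (K := K) (Λ := Λ) (X := P) (Y := M)).fg_top
  refine ⟨⟨s, eq_top_iff.2 fun h _ => ?_⟩⟩
  have hh : h ∈ Submodule.span K (s : Set (P →ₗ[Λ] M)) := hs ▸ Submodule.mem_top
  induction hh using Submodule.span_induction with
  | mem x hx => exact Submodule.subset_span hx
  | zero => exact zero_mem _
  | add x y _ _ hx hy => exact add_mem (hx trivial) (hy trivial)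
  | smul k x _ hx =>
    -- A scalar of `K` acts as precomposition with a multiple of the identity, so a `K`-spanning set
    -- also spans over the endomorphism ring.
    have : k • x = DomMulAct.mk (k • (1 : Module.End Λ P)) • x := by
      ext y
      rw [DomMulAct.mk_smul_linearMap_apply]
      simp [LinearMap.map_smul_of_tower]
    rw [this]
    exact Submodule.smul_mem _ _ (hx trivial)

theorem projective_pi {Λ : Type*} [Ring Λ] {ι : Type*} [Finite ι] (X : ι → Type*)
    [∀ i, AddCommGroup (X i)] [∀ i, Module Λ (X i)] (hX : ∀ i, Module.Projective Λ (X i)) :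
    Module.Projective Λ ((i : ι) → X i) := by
  classical
  have := Fintype.ofFinite ι
  exact Module.Projective.of_equiv' (DirectSum.linearEquivFunOnFintype Λ ι X)

/-! ### The representation space and the modules `N_f` -/

section Rep

variable {K : Type v} {Λ : Type u} [Field K] [Ring Λ] [Algebra K Λ] {n : ℕ}
  {S : Fin n → Type u} [∀ i, AddCommGroup (S i)] [∀ i, Module Λ (S i)]
  {P : Fin n → Type u} [∀ i, AddCommGroup (P i)] [∀ i, Module Λ (P i)]
  [∀ i, Module K (P i)] [∀ i, IsScalarTower K Λ (P i)]
  {π : (i : Fin n) → P i →ₗ[Λ] S i}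
  {d : Fin n → Fin n → ℕ} {α : Fin n → ℕ}
  {φ : (j : Fin n) → ((i : Fin n) → Fin (d j i) → P i) ≃ₗ[Λ] Module.jacobson Λ (P j)}

/-- If `P i` is a summand of the radical of `P j`, then it is smaller than `P j`. -/
theorem finrank_lt_of_summand_jacobson [Module.Finite K Λ]
    [∀ i, IsSimpleModule Λ (S i)] (hπ : ∀ i, IsProjectiveCover (π i))
    (φ : (j : Fin n) → ((i : Fin n) → Fin (d j i) → P i) ≃ₗ[Λ] Module.jacobson Λ (P j))
    {i j : Fin n} (hd : 0 < d j i) : Module.finrank K (P i) < Module.finrank K (P j) := by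
  have := (hπ j).finite
  have : Module.Finite K (P j) := Module.Finite.trans Λ _
  let c : P i →ₗ[Λ] P j := (Module.jacobson Λ (P j)).subtype ∘ₗ (φ j).toLinearMap ∘ₗ
    LinearMap.single Λ (fun i => Fin (d j i) → P i) i ∘ₗ
      LinearMap.single Λ (fun _ : Fin (d j i) => P i) ⟨0, hd⟩
  have hinj : Function.Injective c := Subtype.val_injective.comp ((φ j).injective.comp
    ((Pi.single_injective (M := fun i => Fin (d j i) → P i) i).comp
      (Pi.single_injective (M := fun _ : Fin (d j i) => P i) _)))
  have hlt : LinearMap.range (c.restrictScalars K) ≠ ⊤ := fun h =>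
    (hπ j).jacobson_ne_top <| eq_top_iff.2 fun y _ => by
      obtain ⟨x, rfl⟩ := LinearMap.range_eq_top.1 h y
      exact Subtype.property _
  rw [← LinearMap.finrank_range_of_inj (f := c.restrictScalars K) hinj]
  exact Submodule.finrank_lt hlt

/-- The `i`-th component of `f x` depends only on the components `x j` for which `P i` is a
summand of the radical of `P j`. -/
theorem repSpace_apply_eq_zero {f : radProjSum Λ P α →ₗ[Λ] ProjSum P α}
    (hf : f ∈ repSpace K α φ) (x : radProjSum Λ P α) (i : Fin n)
    (hx : ∀ j, 0 < d j i → x.1 j = 0) : f x i = 0 := by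
  obtain ⟨g, hg⟩ := hf
  obtain ⟨x, rfl⟩ := (radIso α φ).surjective x
  have hfx : f (radIso α φ x) i = g i (fun j a => x j a i) := congr($hg x i).symm
  rw [hfx]
  have h0 : (fun j a => x j a i : RadSumPart P d α i) = 0 := by
    ext j a k
    have h1 : ((φ j (x j a) : Module.jacobson Λ (P j)) : P j) = 0 :=
      congrFun (hx j (Fin.pos k)) a
    have h2 : x j a = 0 := (φ j).map_eq_zero_iff.1 (Subtype.ext h1)
    simp [h2]
  rw [h0, map_zero]

/-- Suppose `f x = x ≠ 0` and take a nonzero component `i` with `P i` of largest dimension. It is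
fed only by components `j` with `P j` strictly larger, which vanish. -/
theorem injective_sub_subtype_of_mem_repSpace [Module.Finite K Λ]
    [∀ i, IsSimpleModule Λ (S i)] (hπ : ∀ i, IsProjectiveCover (π i))
    {f : radProjSum Λ P α →ₗ[Λ] ProjSum P α} (hf : f ∈ repSpace K α φ) :
    Function.Injective (f - (radProjSum Λ P α).subtype) := by
  rw [injective_iff_map_eq_zero]
  intro x hx
  have hx : f x = x.1 := sub_eq_zero.1 hx
  by_contra hne
  have hne' : {i | x.1 i ≠ 0}.Nonempty := by
    by_contra h
    refine hne (Subtype.ext (funext fun i => ?_))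
    by_contra hi
    exact h ⟨i, hi⟩
  obtain ⟨i, hi, hmax⟩ := Set.exists_max_image _ (fun i => Module.finrank K (P i))
    (Set.toFinite _) hne'
  refine hi ?_
  rw [← hx]
  refine repSpace_apply_eq_zero hf x i fun j hj => ?_
  by_contra h
  exact absurd (finrank_lt_of_summand_jacobson (K := K) hπ φ hj) (hmax j h).not_gt

/-- Modulo the image of `f - inc`, every map `P i → P(α)` has image in the block `Pᵢ^{αᵢ}`. -/
theorem exists_reduce_to_block [Module.Finite K Λ]
    (hS : IsCompleteListOfSimples Λ S) (hπ : ∀ i, IsProjectiveCover (π i))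
    {f : radProjSum Λ P α →ₗ[Λ] ProjSum P α} (hf : f ∈ repSpace K α φ) (i : Fin n)
    (c : P i →ₗ[Λ] ProjSum P α) :
    ∃ r : P i →ₗ[Λ] radProjSum Λ P α, ∀ y j, j ≠ i →
      (c y + (f - (radProjSum Λ P α).subtype) (r y)) j = 0 := by
  have := hS.simple
  -- Adding `f - inc` of the off-block part replaces that part by its image under `f`, which lives
  -- in strictly smaller `P j`. So the dimension bound `N` drops by one each time; it starts above
  -- every dimension, where the hypothesis is vacuous.
  suffices H : ∀ (N : ℕ) (c : P i →ₗ[Λ] ProjSum P α),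
      (∀ j, j ≠ i → N ≤ Module.finrank K (P j) → ∀ y, c y j = 0) →
      ∃ r : P i →ₗ[Λ] radProjSum Λ P α, ∀ y j, j ≠ i →
        (c y + (f - (radProjSum Λ P α).subtype) (r y)) j = 0 by
    refine H (∑ j, Module.finrank K (P j) + 1) c fun j _ hj => ?_
    have := Finset.single_le_sum (f := fun j => Module.finrank K (P j))
      (fun _ _ => Nat.zero_le _) (Finset.mem_univ j)
    lia
  intro N
  induction N with
  | zero => exact fun c hc => ⟨0, fun y j hj => by simpa using hc j hj (Nat.zero_le _) y⟩
  | succ N ih =>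
    intro c hc
    let c' : P i →ₗ[Λ] ProjSum P α :=
      LinearMap.pi fun j => if j = i then 0 else LinearMap.proj j ∘ₗ c
    have hc'i (y : P i) : c' y i = 0 := by simp [c']
    have hc' (y : P i) {j : Fin n} (hj : j ≠ i) : c' y j = c y j := by simp [c', hj]
    have hrad (y : P i) : c' y ∈ radProjSum Λ P α := by
      refine (mem_jacobson_pi_iff Λ _ _).2 fun j => (mem_jacobson_pi_iff Λ _ _).2 fun a => ?_
      by_cases hj : j = i
      · subst hj
        rw [hc'i]
        exact zero_mem _
      · rw [hc' y hj]
        exact (hπ i).apply_mem_jacobson (hπ j)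
          ⟨fun e => hj (hS.eq_of_iso i j ⟨e⟩).symm⟩ (LinearMap.proj a ∘ₗ LinearMap.proj j ∘ₗ c) y
    let r₁ : P i →ₗ[Λ] radProjSum Λ P α := c'.codRestrict _ hrad
    have hr₁ (y : P i) {j : Fin n} (hj : j ≠ i) :
        (c y + (f - (radProjSum Λ P α).subtype) (r₁ y)) j = f (r₁ y) j := by
      have : (r₁ y).1 j = c y j := hc' y hj
      simp [this]
    obtain ⟨r₂, hr₂⟩ := ih (c + (f - (radProjSum Λ P α).subtype) ∘ₗ r₁) fun j hj hN y => by
      refine (hr₁ y hj).trans (repSpace_apply_eq_zero hf _ j fun j' hj' => ?_)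
      change c' y j' = 0
      by_cases hj'i : j' = i
      · subst hj'i
        exact hc'i y
      · rw [hc' y hj'i]
        have := finrank_lt_of_summand_jacobson (K := K) hπ φ hj'
        exact hc j' hj'i (by lia) y
    refine ⟨r₁ + r₂, fun y j hj => ?_⟩
    rw [← hr₂ y j hj, LinearMap.add_apply, map_add, ← add_assoc]
    rfl

/-- A nonzero finitely generated module has a simple quotient, and the projective cover of that
quotient lifts to it. This is the test that a cokernel or kernel vanishes. -/
theorem exists_ne_zero_hom_of_nontrivial (hS : IsCompleteListOfSimples Λ S)
    (hπ : ∀ i, IsProjectiveCover (π i)) (X : Type u) [AddCommGroup X] [Module Λ X]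
    [Module.Finite Λ X] [Nontrivial X] : ∃ (i : Fin n) (c : P i →ₗ[Λ] X), c ≠ 0 := by
  obtain ⟨N, hN, -⟩ := (eq_top_or_exists_le_coatom (⊥ : Submodule Λ X)).resolve_left bot_ne_top
  have hs := isSimpleModule_iff_isCoatom.2 hN
  obtain ⟨i, ⟨e⟩⟩ := hS.exhaustive (X ⧸ N) hs
  have := (hπ i).projective
  obtain ⟨c, hc⟩ := Module.projective_lifting_property N.mkQ (e.symm.toLinearMap ∘ₗ π i)
    N.mkQ_surjective
  refine ⟨i, c, ?_⟩
  rintro rfl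
  have := hs.nontrivial
  obtain ⟨x, hx⟩ := exists_ne (0 : X ⧸ N)
  obtain ⟨y, hy⟩ := (hπ i).surjective (e x)
  refine hx ?_
  have := congr($hc y)
  simpa [hy] using this.symm

/-- Every finitely generated module of dimension vector `α` is of the form `N_f`. -/
theorem nonempty_isoLocus [Module.Finite K Λ] (hΛ : IsHereditaryRing Λ)
    (hS : IsCompleteListOfSimples Λ S) (hπ : ∀ i, IsProjectiveCover (π i))
    (M : Type u) [AddCommGroup M] [Module Λ M] [Module.Finite Λ M]
    (hdim : dimVector Λ P M = α) : (isoLocus K (α := α) φ M).Nonempty := by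
  have := hS.simple
  have : IsArtinianRing Λ := IsArtinianRing.of_finite K Λ
  have (i : Fin n) := (hπ i).finite
  have (i : Fin n) := (hπ i).projective
  have (i : Fin n) : Module.Finite K (P i) := Module.Finite.trans Λ _
  have hbasis (i : Fin n) : ∃ m : Fin (α i) → (P i →ₗ[Λ] M),
      (∀ h : P i →ₗ[Λ] M, ∃ t : Fin (α i) → (P i →ₗ[Λ] P i), ∑ a, m a ∘ₗ t a = h) ∧
      ∀ t : Fin (α i) → (P i →ₗ[Λ] P i), ∑ a, m a ∘ₗ t a = 0 → t = 0 := by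
    have := finite_hom_dma (K := K) (Λ := Λ) (P := P i) (M := M)
    have := (hS.simple i).nontrivial
    have := (hπ i).surjective.nontrivial
    exact exists_basis_hom (fun c hc => (hπ i).bijective_of_ne_zero hΛ hc) (congrFun hdim i)
  choose m hspan hindep using hbasis
  choose t ht using hspan
  have ht' (i : Fin n) (h : P i →ₗ[Λ] M) (y : P i) : ∑ a, m i a (t i h a y) = h y := by
    simpa using congr($(ht i h) y)
  let p : ProjSum P α →ₗ[Λ] M := ∑ i, ∑ a, m i a ∘ₗ LinearMap.proj a ∘ₗ LinearMap.proj i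
  have hp (x : ProjSum P α) : p x = ∑ i, ∑ a, m i a (x i a) := by simp [p]
  have hpi (i : Fin n) (x : ProjSum P α) (hx : ∀ j, j ≠ i → x j = 0) :
      p x = ∑ a, m i a (x i a) := by
    rw [hp]
    exact Finset.sum_eq_single i (fun j _ hj => by simp [hx j hj]) (by simp)
  -- A nonzero map from `P i` to the cokernel would lift to `M`; the lift is a combination of the `m
  -- i a`, hence lands in the range of `p`.
  have hpsurj : Function.Surjective p := by
    rw [← LinearMap.range_eq_top]
    by_contra h
    have := Submodule.Quotient.nontrivial_iff.2 h
    obtain ⟨i, c, hc⟩ := exists_ne_zero_hom_of_nontrivial hS hπ (M ⧸ LinearMap.range p)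
    obtain ⟨c', hc'⟩ := Module.projective_lifting_property (LinearMap.range p).mkQ c
      (Submodule.mkQ_surjective _)
    refine hc (LinearMap.ext fun y => ?_)
    rw [← hc']
    refine (Submodule.Quotient.mk_eq_zero _).2
      ⟨Pi.single i fun a => t i c' a y, ?_⟩
    rw [hpi i _ fun j hj => Pi.single_eq_of_ne hj _, ← ht' i c' y]
    simp
  let h (j : Fin n) (a : Fin (α j)) (i : Fin n) (k : Fin (d j i)) : P i →ₗ[Λ] M :=
    m j a ∘ₗ (Module.jacobson Λ (P j)).subtype ∘ₗ (φ j).toLinearMap ∘ₗ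
      LinearMap.single Λ (fun i => Fin (d j i) → P i) i ∘ₗ
        LinearMap.single Λ (fun _ : Fin (d j i) => P i) k
  have hh (j : Fin n) (a : Fin (α j)) (z : (i : Fin n) → Fin (d j i) → P i) :
      m j a (φ j z) = ∑ i, ∑ k, h j a i k (z i k) := by
    have hz : z = ∑ i, ∑ k, Pi.single i (Pi.single k (z i k)) := by
      conv_lhs => rw [← Finset.univ_sum_single z]
      refine Finset.sum_congr rfl fun i _ => ?_
      conv_lhs => rw [← Finset.univ_sum_single (z i)]
      exact map_sum (LinearMap.single Λ (fun i => Fin (d j i) → P i) i) _ _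
    conv_lhs => rw [hz]
    simp [h]
  -- The coefficients of `h j a i k` in the basis `m i`, chosen so that `p ∘ f` agrees with `p` on
  -- the radical. Only `P i → P i` maps occur, hence block diagonality.
  let g (i : Fin n) : RadSumPart P d α i →ₗ[Λ] (Fin (α i) → P i) :=
    LinearMap.pi fun a' => ∑ j, ∑ a, ∑ k, t i (h j a i k) a' ∘ₗ LinearMap.proj k ∘ₗ
      LinearMap.proj a ∘ₗ LinearMap.proj j
  have hg (i : Fin n) (x : RadSumPart P d α i) :
      ∑ a', m i a' (g i x a') = ∑ j, ∑ a, ∑ k, h j a i k (x j a k) := by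
    simp only [g, LinearMap.pi_apply, LinearMap.sum_apply, LinearMap.comp_apply,
      LinearMap.proj_apply, map_sum]
    refine Finset.sum_comm.trans (Finset.sum_congr rfl fun j _ => ?_)
    refine Finset.sum_comm.trans (Finset.sum_congr rfl fun a _ => ?_)
    exact Finset.sum_comm.trans (Finset.sum_congr rfl fun k _ => ht' i _ _)
  let f : radProjSum Λ P α →ₗ[Λ] ProjSum P α :=
    blockDiagonal K Λ P d α g ∘ₗ (radIso α φ).symm.toLinearMap
  have hf : f ∈ repSpace K α φ := ⟨g, LinearMap.ext fun x => by simp [f]⟩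
  have hpf (x : radProjSum Λ P α) : p ((f - (radProjSum Λ P α).subtype) x) = 0 := by
    obtain ⟨x, rfl⟩ := (radIso α φ).surjective x
    rw [LinearMap.sub_apply, map_sub, sub_eq_zero, hp, hp]
    have h1 (i : Fin n) : f (radIso α φ x) i = g i (fun j a => x j a i) := by
      simp [f, blockDiagonal]
    have h2 (j : Fin n) (a : Fin (α j)) :
        (radProjSum Λ P α).subtype (radIso α φ x) j a = φ j (x j a) := rfl
    simp only [h1, hg, h2, hh]
    rw [Finset.sum_comm]
    refine Finset.sum_congr rfl fun j _ => ?_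
    rw [Finset.sum_comm]
  let q : repCoker f →ₗ[Λ] M := Submodule.liftQ _ p (by rintro _ ⟨x, rfl⟩; exact hpf x)
  have hqsurj : Function.Surjective q := fun y => by
    obtain ⟨x, rfl⟩ := hpsurj y
    exact ⟨Submodule.Quotient.mk x, rfl⟩
  -- A map from `P i` to the kernel lifts to `P(α)`. Modulo the range of `f - inc` the lift lies in
  -- block `i`, where `p` kills it, so it is a linear relation among the `m i a`.
  have hqinj : LinearMap.ker q = ⊥ := by
    by_contra hne
    have := Submodule.nontrivial_iff_ne_bot.2 hne
    obtain ⟨i, c, hc⟩ := exists_ne_zero_hom_of_nontrivial hS hπ (LinearMap.ker q)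
    obtain ⟨c', hc'⟩ := Module.projective_lifting_property
      (LinearMap.range (f - (radProjSum Λ P α).subtype)).mkQ ((LinearMap.ker q).subtype ∘ₗ c)
      (Submodule.mkQ_surjective _)
    obtain ⟨r, hr⟩ := exists_reduce_to_block hS hπ hf i c'
    let c'' : P i →ₗ[Λ] ProjSum P α := c' + (f - (radProjSum Λ P α).subtype) ∘ₗ r
    have hpc (y : P i) : p (c'' y) = 0 := by
      have h1 : p (c' y) = q ((LinearMap.ker q).subtype (c y)) := congrArg q congr($hc' y)
      have h2 : p (c'' y) = p (c' y) + p ((f - (radProjSum Λ P α).subtype) (r y)) :=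
        map_add p _ _
      rw [h2, hpf, h1, add_zero]
      exact (c y).2
    have ht0 := hindep i (fun a => LinearMap.proj a ∘ₗ LinearMap.proj i ∘ₗ c'') <| by
      ext y
      simpa [hpi i (c'' y) (hr y)] using hpc y
    have hc'' (y : P i) : c'' y = 0 := by
      ext j a
      by_cases hj : j = i
      · subst hj
        exact congr($ht0 a y)
      · exact congrFun (hr y j hj) a
    refine hc (LinearMap.ext fun y => Subtype.ext ?_)
    refine (congr($hc' y)).symm.trans ((Submodule.Quotient.mk_eq_zero _).2 ⟨-r y, ?_⟩)
    rw [map_neg, eq_comm]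
    exact eq_neg_of_add_eq_zero_left (hc'' y)
  exact ⟨⟨f, hf⟩, ⟨LinearEquiv.ofBijective q ⟨LinearMap.ker_eq_bot.1 hqinj, hqsurj⟩⟩⟩

/-- The radical of `P(α)` is projective because `φ` identifies it with a sum of copies of the `P i`,
so the deformation argument applies at every point of the locus. -/
theorem isOpen_isoLocus [Module.Finite K Λ]
    [∀ i, IsSimpleModule Λ (S i)] (hπ : ∀ i, IsProjectiveCover (π i))
    (M : Type u) [AddCommGroup M] [Module Λ M] (hM : IsRigid Λ M) :
    IsOpen[zariskiTopology K (repSpace K α φ)] (isoLocus K φ M) := by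
  have (i : Fin n) := (hπ i).finite
  have (i : Fin n) : Module.Finite K (P i) := Module.Finite.trans Λ _
  have : Module.Finite K (radProjSum Λ P α) := Module.Finite.of_injective
    ((radProjSum Λ P α).subtype.restrictScalars K) Subtype.val_injective
  have : Module.Projective Λ (ProjSum P α) :=
    projective_pi _ fun i => projective_pi _ fun _ => (hπ i).projective
  have : Module.Projective Λ (RadSum P d α) :=
    projective_pi _ fun j => projective_pi _ fun _ => projective_pi _ fun i =>
      projective_pi _ fun _ => (hπ i).projective
  have : Module.Projective Λ (radProjSum Λ P α) := Module.Projective.of_equiv' (radIso α φ)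
  refine isOpen_zariski_of_forall fun f hf => ?_
  obtain ⟨e⟩ := hf
  exact exists_polyFunctions_quotient_equiv (repSpace K α φ) (radProjSum Λ P α).subtype f
    (injective_sub_subtype_of_mem_repSpace hπ f.2) e hM

end Rep

/-! ### The generic representation -/

theorem theorem2p1p6 {K : Type v} {Λ : Type u} [Field K] [Infinite K] [Ring Λ] [Algebra K Λ]
    [Module.Finite K Λ] (hΛ : IsHereditaryRing Λ) {n : ℕ}
    -- the simple modules `S₁, …, Sₙ`
    (S : Fin n → Type u) [∀ i, AddCommGroup (S i)] [∀ i, Module Λ (S i)]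
    (hS : IsCompleteListOfSimples Λ S)
    -- their projective covers `P₁, …, Pₙ`
    (P : Fin n → Type u) [∀ i, AddCommGroup (P i)] [∀ i, Module Λ (P i)]
    [∀ i, Module K (P i)] [∀ i, IsScalarTower K Λ (P i)]
    (π : (i : Fin n) → P i →ₗ[Λ] S i) (hπ : ∀ i, IsProjectiveCover (π i))
    -- a choice of decompositions of the radicals
    (φ : (j : Fin n) →
      ((i : Fin n) → Fin (extDim Λ S j i) → P i) ≃ₗ[Λ] Module.jacobson Λ (P j))
    (α : Fin n → ℕ)
    (M : Type u) [AddCommGroup M] [Module Λ M] [Module.Finite Λ M]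
    (hM : IsRigid Λ M) (hdim : dimVector Λ P M = α) :
    IsOpen[zariskiTopology K (repSpace K α φ)] (isoLocus K φ M) ∧
    @Dense _ (zariskiTopology K (repSpace K α φ)) (isoLocus K φ M) ∧
    -- the generic representation is determined by `α`: it is the only module whose isomorphism
    -- class is open and dense, and the only rigid module of dimension vector `α`
    (∀ (N : Type u) [AddCommGroup N] [Module Λ N],
      IsOpen[zariskiTopology K (repSpace K α φ)] (isoLocus K φ N) →
      @Dense _ (zariskiTopology K (repSpace K α φ)) (isoLocus K φ N) →
      Nonempty (N ≃ₗ[Λ] M)) ∧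
    (∀ (N : Type u) [AddCommGroup N] [Module Λ N] [Module.Finite Λ N],
      IsRigid Λ N → dimVector Λ P N = α → Nonempty (N ≃ₗ[Λ] M)) := by
  have := hS.simple
  have hopen := isOpen_isoLocus (K := K) (α := α) (φ := φ) hπ M hM
  have hne := nonempty_isoLocus (K := K) (φ := φ) hΛ hS hπ M hdim
  have hdense := dense_zariski_of_isOpen hopen hne
  refine ⟨hopen, hdense, fun N _ _ _ hN => ?_, fun N _ _ _ hN hNdim => ?_⟩
  · obtain ⟨f, ⟨e⟩, ⟨e'⟩⟩ := @Dense.inter_open_nonempty _ (zariskiTopology K _) _ hN _ hopen hne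
    exact ⟨e'.symm.trans e⟩
  · obtain ⟨f, ⟨e⟩, ⟨e'⟩⟩ := @Dense.inter_open_nonempty _ (zariskiTopology K _) _ hdense _
      (isOpen_isoLocus (K := K) (α := α) (φ := φ) hπ N hN)
      (nonempty_isoLocus (K := K) (φ := φ) hΛ hS hπ N hNdim)
    exact ⟨e.symm.trans e'⟩
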